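/- Let $A$ and $B$ be finite-dimensional quantum systems of positive dimension, and let $\mathrm{CPTNI}$ and $\mathrm{CPTP}$ denote the completely positive linear maps between operators that are, respectively, trace-non-increasing on positive semidefinite operators and trace-preserving. For a Hermiticity-preserving linear map $\Phi$ from the operators on $A$ to the operators on $B$, define the robustness $$R(\Phi)=\min\Big\{\lambda\ge 0 : \tfrac{\Phi+\lambda\Lambda}{1+\lambda}\in\mathrm{CPTNI}(A,B)\text{ for some }\Lambda\in\mathrm{CPTNI}(A,B)\Big\}$$ and the simulation cost $$S(\Phi)=\min\big\{\|X\|_1 : X\text{ a Hermitian operator on }A',\ \operatorname{Tr}X=1,\ \Lambda\in\mathrm{CPTNI}(A\otimes A',B),\ \Lambda(\,\cdot\otimes X)=\Phi(\cdot)\big\},$$ where $\|X\|_1=\operatorname{Tr}\sqrt{X^\dagger X}$ and the ancilla $A'$ ranges over all finite-dimensional systems. Then, for every Hermiticity-preserving $\Phi$, both minima are attained and $$S(\Phi)=2R(\Phi)+1,$$ and the minimum $S(\Phi)$ is already attained on an ancilla $A'$ of any prescribed dimension $d\ge 2$. If moreover $\Phi$ is trace-preserving, then $$S(\Phi)=\|\Phi\|_\diamond:=\max_{\rho}\big\|(\mathrm{id}_A\otimes\Phi)(\rho)\big\|_1,$$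 where the maximum, which is attained, runs over the density operators $\rho$ on $A\otimes A$; and, for an ancilla of any dimension $d\ge2$, an optimal simulation can be chosen with $\Lambda\in\mathrm{CPTP}(A\otimes A',B)$. -/

import Mathlib

open scoped ComplexOrder MatrixOrder Kronecker

noncomputable section

namespace MapSimulation

/-- Linear maps from the operators on a system with orthonormal basis `A` to the operators on a
system with orthonormal basis `B`. -/
abbrev OpMap (A B : Type*) : Type _ := Matrix A A ℂ →ₗ[ℂ] Matrix B B ℂ

/-- The map `id_R ⊗ Φ`, which applies `Φ` to every block of an operator on `R ⊗ A`. -/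
def idTensor (R : Type*) {A B : Type*} (Φ : OpMap A B) : OpMap (R × A) (R × B) where
  toFun M := Matrix.of fun p q => Φ (Matrix.of fun a a' => M (p.1, a) (q.1, a')) p.2 q.2
  map_add' M N := by
    ext p q
    exact congrFun (congrFun (Φ.map_add _ _) p.2) q.2
  map_smul' c M := by
    ext p q
    exact congrFun (congrFun (Φ.map_smul c _) p.2) q.2

/-- `id_R ⊗ Φ` sends a product `M ⊗ N` to `M ⊗ Φ(N)`. -/
theorem idTensor_kronecker {R A B : Type*} (Φ : OpMap A B)
    (M : Matrix R R ℂ) (N : Matrix A A ℂ) : idTensor R Φ (M ⊗ₖ N) = M ⊗ₖ Φ N := by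
  ext p q
  exact congrFun (congrFun (Φ.map_smul (M p.1 q.1) N) p.2) q.2

/-- Hermitian operators are sent to Hermitian operators. -/
def IsHermiticityPreserving {A B : Type*} (Φ : OpMap A B) : Prop :=
  ∀ X : Matrix A A ℂ, X.IsHermitian → (Φ X).IsHermitian

/-- Positive semidefinite operators are sent to positive semidefinite operators. -/
def IsPositiveMap {A B : Type*} (Φ : OpMap A B) : Prop :=
  ∀ X : Matrix A A ℂ, X.PosSemidef → (Φ X).PosSemidef

/-- Complete positivity: `id_A ⊗ Φ` is positive. -/
def IsCP {A B : Type*} (Φ : OpMap A B) : Prop :=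
  IsPositiveMap (idTensor A Φ)

/-- Trace preservation. -/
def IsTP {A B : Type*} [Fintype A] [Fintype B] (Φ : OpMap A B) : Prop :=
  ∀ X : Matrix A A ℂ, (Φ X).trace = X.trace

/-- The trace does not increase on positive semidefinite operators. (For completely positive maps,
the only ones for which this is used, both traces are real.) -/
def IsTNI {A B : Type*} [Fintype A] [Fintype B] (Φ : OpMap A B) : Prop :=
  ∀ X : Matrix A A ℂ, X.PosSemidef → (Φ X).trace.re ≤ X.trace.re

/-- Completely positive and trace-non-increasing maps. -/
def IsCPTNI {A B : Type*} [Fintype A] [Fintype B] (Φ : OpMap A B) : Prop :=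
  IsCP Φ ∧ IsTNI Φ

/-- Completely positive and trace-preserving maps. -/
def IsCPTP {A B : Type*} [Fintype A] [Fintype B] (Φ : OpMap A B) : Prop :=
  IsCP Φ ∧ IsTP Φ

/-- Density operators. -/
def IsDensity {A : Type*} [Fintype A] (ρ : Matrix A A ℂ) : Prop :=
  ρ.PosSemidef ∧ ρ.trace = 1

/-- The trace norm `‖X‖₁ = Tr √(X† X)`. -/
def traceNorm {A : Type*} [Fintype A] [DecidableEq A] (X : Matrix A A ℂ) : ℝ :=
  (CFC.sqrt (X.conjTranspose * X)).trace.re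

/-- The values `‖(id_A ⊗ Φ)(ρ)‖₁` over the states `ρ` of `A ⊗ A`. -/
def diamondValues {A B : Type*} [Fintype A] [DecidableEq A] [Fintype B] [DecidableEq B]
    (Φ : OpMap A B) : Set ℝ :=
  {c | ∃ ρ : Matrix (A × A) (A × A) ℂ, IsDensity ρ ∧ c = traceNorm (idTensor A Φ ρ)}

/-- The diamond norm of a Hermiticity-preserving map. -/
def diamondNorm {A B : Type*} [Fintype A] [DecidableEq A] [Fintype B] [DecidableEq B]
    (Φ : OpMap A B) : ℝ :=
  sSup (diamondValues Φ)

/-- The `r ≥ 0` for which `(Φ + r Λ) / (1 + r)` is completely positive and trace-non-increasing for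
some completely positive and trace-non-increasing `Λ`. -/
def robustnessValues {A B : Type*} [Fintype A] [Fintype B] (Φ : OpMap A B) : Set ℝ :=
  {r | 0 ≤ r ∧ ∃ Λ : OpMap A B, IsCPTNI Λ ∧ IsCPTNI ((1 + r)⁻¹ • (Φ + r • Λ))}

/-- The robustness `R(Φ)`. -/
def robustness {A B : Type*} [Fintype A] [Fintype B] (Φ : OpMap A B) : ℝ :=
  sInf (robustnessValues Φ)

/-- The operator `X` on the ancilla `K` and the map `Λ` simulate `Φ`: `X` is Hermitian with unit
trace and `Λ(· ⊗ X) = Φ(·)`. -/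
def Simulates {A B K : Type*} [Fintype K]
    (Φ : OpMap A B) (Λ : OpMap (A × K) B) (X : Matrix K K ℂ) : Prop :=
  X.IsHermitian ∧ X.trace = 1 ∧ ∀ ρ : Matrix A A ℂ, Λ (ρ ⊗ₖ X) = Φ ρ

/-- The costs `‖X‖₁` of the simulations of `Φ` with a completely positive and trace-non-increasing
map and the ancilla `K`. -/
def simulationCostsOn (K : Type*) {A B : Type*} [Fintype K] [DecidableEq K] [Fintype A] [Fintype B]
    (Φ : OpMap A B) : Set ℝ :=
  {c | ∃ (Λ : OpMap (A × K) B) (X : Matrix K K ℂ),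
    IsCPTNI Λ ∧ Simulates Φ Λ X ∧ c = traceNorm X}

/-- The costs of all simulations of `Φ`, with ancillas of arbitrary finite dimension. -/
def simulationCosts {A B : Type*} [Fintype A] [Fintype B] (Φ : OpMap A B) : Set ℝ :=
  ⋃ d : ℕ, simulationCostsOn (Fin d) Φ

/-- The simulation cost `S(Φ)`. -/
def simulationCost {A B : Type*} [Fintype A] [Fintype B] (Φ : OpMap A B) : ℝ :=
  sInf (simulationCosts Φ)

end MapSimulation

end

open scoped ComplexOrder MatrixOrder Kronecker

noncomputable section

namespace MapSimulation

/-! ### Trace norm, Jordan decomposition, and compactness of sets of positive operators. -/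

section TraceNorm
variable {n : Type*} [Fintype n] [DecidableEq n]

/-! Robustness and simulation cost encode the same data. Split a unit-trace ancilla operator into
its Jordan parts, `X = P - N`. Then `‖X‖₁ = Tr P + Tr N = 2 r + 1` with `r = Tr N`, and feeding `P`
and `N` to the simulating map yields, after normalisation, CPTNI maps with `(1 + r) Ψ = Φ + r Λ`
(`Simulates.exists_mem_robustnessValues`). Conversely, such a pair is simulated by measuring the
ancilla in its basis and applying `Ψ` or `Λ` according to the outcome, with `X = (1 + r)|k₀⟩⟨k₀| -
r|k₁⟩⟨k₁|` (`simulates_blockSum`). Two ancilla levels therefore suffice. Attainment of `R` is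
compactness of a set of Choi matrices.

For trace-preserving `Φ`, the triangle inequality gives `‖Φ‖_⋄ ≤ 2 R + 1`. The reverse inequality
needs one CP map above `Φ` whose output trace is at most about `c = (‖Φ‖_⋄ + 1) / 2` on every state.
For a single faithful state, take the positive part of `id ⊗ Φ` at a purification and undo the
purification. Sion's minimax theorem then exchanges "for each state" and "there is a map"
(`exists_posSemidef_forall_re_trace_le`). It is applied to states `σ ≥ δ`, where the candidate maps
form a compact set; the loss from `δ` is absorbed by taking `r` slightly above the optimum.

Finally, CPTNI pairs become CPTP pairs by adding to both maps multiples of the CP map that replaces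
the trace lost by `Λ` (`exists_isCPTP_of_isTP`). -/

theorem traceNorm_eq_sum_abs_eigenvalues {H : Matrix n n ℂ} (hH : H.IsHermitian) :
    traceNorm H = ∑ i, |hH.eigenvalues i| := by
  have h : CFC.sqrt (H.conjTranspose * H) = hH.cfc (fun x => ‖x‖) := by
    rw [← hH.cfc_eq]
    exact CFC.abs_eq_cfc_norm H hH.isSelfAdjoint
  rw [traceNorm, h, Matrix.IsHermitian.cfc, Unitary.conjStarAlgAut_apply, Matrix.trace_mul_cycle,
    Unitary.coe_star_mul_self, Matrix.one_mul, Matrix.trace_diagonal, Complex.re_sum]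
  simp

omit [DecidableEq n] in
theorem re_trace_nonneg {P : Matrix n n ℂ} (hP : P.PosSemidef) : 0 ≤ P.trace.re :=
  (Complex.le_def.1 hP.trace_nonneg).1

/-- In an eigenbasis of `P - N`, each eigenvalue is a difference `p - n` of nonnegative diagonal
entries, and `|p - n| ≤ p + n`. -/
theorem traceNorm_sub_le {P N : Matrix n n ℂ} (hP : P.PosSemidef) (hN : N.PosSemidef) :
    traceNorm (P - N) ≤ P.trace.re + N.trace.re := by
  have hH : (P - N).IsHermitian := hP.isHermitian.sub hN.isHermitian
  set U : Matrix n n ℂ := (hH.eigenvectorUnitary : Matrix n n ℂ)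
  have hUU : U * star U = 1 := Unitary.coe_mul_star_self _
  have htr : ∀ M : Matrix n n ℂ, M.trace.re = ∑ i, ((star U * M * U) i i).re := by
    intro M
    have : (star U * M * U).trace = M.trace := by
      rw [Matrix.trace_mul_cycle, hUU, Matrix.one_mul]
    rw [← this, Matrix.trace, Complex.re_sum]
    rfl
  rw [traceNorm_eq_sum_abs_eigenvalues hH, htr P, htr N, ← Finset.sum_add_distrib]
  refine Finset.sum_le_sum fun i _ => ?_
  have hp : 0 ≤ ((star U * P * U) i i).re :=
    (Complex.le_def.1 (hP.conjTranspose_mul_mul_same U).diag_nonneg).1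
  have hn : 0 ≤ ((star U * N * U) i i).re :=
    (Complex.le_def.1 (hN.conjTranspose_mul_mul_same U).diag_nonneg).1
  have he : hH.eigenvalues i = ((star U * P * U) i i).re - ((star U * N * U) i i).re := by
    have h1 : star U * (P - N) * U = Matrix.diagonal (RCLike.ofReal ∘ hH.eigenvalues) := by
      have := hH.conjStarAlgAut_star_eigenvectorUnitary
      simpa [Unitary.conjStarAlgAut_apply] using this
    have h2 := congrFun (congrFun h1 i) i
    rw [Matrix.mul_sub, Matrix.sub_mul] at h2
    have h3 := congrArg Complex.re h2
    simpa using h3.symm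
  rw [he, abs_le]
  constructor <;> linarith

/-- The Jordan decomposition attains equality in `traceNorm_sub_le`, since `|H| = H⁺ + H⁻`. -/
theorem exists_posSemidef_sub_eq {H : Matrix n n ℂ} (hH : H.IsHermitian) :
    ∃ P N : Matrix n n ℂ, P.PosSemidef ∧ N.PosSemidef ∧ H = P - N ∧
      traceNorm H = P.trace.re + N.trace.re := by
  have hs : IsSelfAdjoint H := hH.isSelfAdjoint
  refine ⟨H⁺, H⁻, Matrix.nonneg_iff_posSemidef.1 (CFC.posPart_nonneg H),
    Matrix.nonneg_iff_posSemidef.1 (CFC.negPart_nonneg H),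
    (CFC.posPart_sub_negPart H hs).symm, ?_⟩
  have h : CFC.sqrt (H.conjTranspose * H) = H⁺ + H⁻ := CFC.posPart_add_negPart H hs |>.symm
  rw [traceNorm, h, Matrix.trace_add, Complex.add_re]

open scoped Matrix.Norms.L2Operator in
theorem continuous_traceNorm : Continuous (traceNorm : Matrix n n ℂ → ℝ) := by
  have h : Continuous (CFC.abs : Matrix n n ℂ → Matrix n n ℂ) := CFC.continuous_abs
  exact Complex.continuous_re.comp h.matrix_trace

open scoped Matrix.Norms.L2Operator in
theorem isClosed_posSemidef : IsClosed {P : Matrix n n ℂ | P.PosSemidef} := by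
  have := CStarAlgebra.isClosed_nonneg (A := Matrix n n ℂ)
  simpa only [Matrix.nonneg_iff_posSemidef] using this

omit [DecidableEq n] in
-- A 2×2 minor gives `|P i j|² ≤ P i i * P j j`, and each diagonal entry is at most the trace.
theorem norm_apply_le_re_trace {P : Matrix n n ℂ} (hP : P.PosSemidef) (i j : n) :
    ‖P i j‖ ≤ P.trace.re := by
  have hdiag : ∀ k, 0 ≤ (P k k).re := fun k => (Complex.le_def.1 hP.diag_nonneg).1
  have hle : ∀ k, (P k k).re ≤ P.trace.re := by
    intro k
    rw [Matrix.trace, Complex.re_sum]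
    exact Finset.single_le_sum (f := fun k => (P k k).re) (fun k _ => hdiag k) (Finset.mem_univ k)
  have hdet := (hP.submatrix ![i, j]).det_nonneg
  rw [Matrix.det_fin_two] at hdet
  have hji : P j i = star (P i j) := (hP.isHermitian.apply j i).symm
  have hre := (Complex.le_def.1 hdet).1
  have hi := (Complex.le_def.1 (hP.diag_nonneg (i := i))).2
  have hj := (Complex.le_def.1 (hP.diag_nonneg (i := j))).2
  simp only [Matrix.submatrix_apply, Matrix.cons_val_zero, Matrix.cons_val_one, hji,
    Complex.sub_re, Complex.mul_re, ← hi, ← hj] at hre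
  simp at hre
  have hsq : ‖P i j‖ ^ 2 = (P i j).re * (P i j).re + (P i j).im * (P i j).im := by
    rw [Complex.sq_norm, Complex.normSq_apply]
  have htr : 0 ≤ P.trace.re := re_trace_nonneg hP
  refine abs_le_of_sq_le_sq' ?_ htr |>.2
  rw [hsq]
  nlinarith [mul_le_mul (hle i) (hle j) (hdiag j) htr]

theorem isCompact_posSemidef_trace_le (c : ℝ) :
    IsCompact {P : Matrix n n ℂ | P.PosSemidef ∧ P.trace.re ≤ c} := by
  have hK : IsCompact (X := Matrix n n ℂ)
      (Set.univ.pi fun _ => Set.univ.pi fun _ => Metric.closedBall (0 : ℂ) c) :=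
    isCompact_univ_pi fun _ => isCompact_univ_pi fun _ => isCompact_closedBall 0 c
  refine hK.of_isClosed_subset ?_ ?_
  · exact isClosed_posSemidef.inter
      (isClosed_le (Complex.continuous_re.comp continuous_id.matrix_trace) continuous_const)
  · rintro P ⟨hP, hc⟩ i - j -
    simpa using (norm_apply_le_re_trace hP i j).trans hc

theorem isCompact_density : IsCompact {ρ : Matrix n n ℂ | IsDensity ρ} := by
  refine (isCompact_posSemidef_trace_le 1).of_isClosed_subset ?_ ?_
  · exact isClosed_posSemidef.inter (isClosed_eq continuous_id.matrix_trace continuous_const)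
  · rintro ρ ⟨hρ, h⟩
    exact ⟨hρ, by simp [h]⟩

end TraceNorm

/-! ### Choi matrices and complete positivity. -/

section Choi
variable {A B K : Type*} [Fintype A] [DecidableEq A] [Fintype B] [DecidableEq B]

/-- The Choi matrix of a map. -/
def choi : OpMap A B →ₗ[ℂ] Matrix (A × B) (A × B) ℂ where
  toFun Φ := Matrix.of fun p q => Φ (Matrix.single p.1 q.1 1) p.2 q.2
  map_add' _ _ := rfl
  map_smul' _ _ := rfl

/-- The map with a given Choi matrix. -/
def ofChoi (J : Matrix (A × B) (A × B) ℂ) : OpMap A B where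
  toFun M := Matrix.of fun b b' => ∑ a, ∑ a', M a a' * J (a, b) (a', b')
  map_add' M N := by
    ext b b'
    simp [add_mul, Finset.sum_add_distrib]
  map_smul' c M := by
    ext b b'
    simp [Finset.mul_sum, mul_assoc]

omit [Fintype A] [Fintype B] [DecidableEq B] in
theorem choi_apply (Φ : OpMap A B) (p q : A × B) :
    choi Φ p q = Φ (Matrix.single p.1 q.1 1) p.2 q.2 := rfl

omit [DecidableEq A] [Fintype B] [DecidableEq B] in
theorem ofChoi_apply (J : Matrix (A × B) (A × B) ℂ) (M : Matrix A A ℂ) (b b' : B) :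
    ofChoi J M b b' = ∑ a, ∑ a', M a a' * J (a, b) (a', b') := rfl

omit [Fintype B] [DecidableEq B] in
@[simp] theorem ofChoi_choi (Φ : OpMap A B) : ofChoi (choi Φ) = Φ := by
  refine LinearMap.ext fun M => ?_
  conv_rhs => rw [Matrix.matrix_eq_sum_single M]
  ext b b'
  simp only [ofChoi_apply, choi_apply, map_sum, Matrix.sum_apply]
  refine Finset.sum_congr rfl fun a _ => Finset.sum_congr rfl fun a' _ => ?_
  have : Matrix.single a a' (M a a') = M a a' • Matrix.single a a' (1 : ℂ) := by simp
  rw [this, map_smul]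
  rfl

omit [Fintype B] [DecidableEq B] in
@[simp] theorem choi_ofChoi (J : Matrix (A × B) (A × B) ℂ) : choi (ofChoi J) = J := by
  ext ⟨a, b⟩ ⟨a', b'⟩
  rw [choi_apply, ofChoi_apply]
  simp [Matrix.single_apply, ite_and]

/-- The map `M ↦ G M Gᴴ`. -/
def conjMap (G : Matrix A A ℂ) : OpMap A A where
  toFun M := G * M * G.conjTranspose
  map_add' M N := by rw [Matrix.mul_add, Matrix.add_mul]
  map_smul' c M := by simp

omit [Fintype B] [DecidableEq B] in
-- The vector on the right purifies `G Gᴴ`. Thus `G = 1` recovers the Choi matrix of `Φ`, and an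
-- invertible `G` relates it to the output of `id ⊗ Φ` at a purified faithful state.
theorem choi_comp_conjMap (Φ : OpMap A B) (G : Matrix A A ℂ) :
    choi (Φ ∘ₗ conjMap G) =
      idTensor A Φ (Matrix.vecMulVec (fun p => G p.2 p.1) (star fun p => G p.2 p.1)) := by
  ext ⟨r, b⟩ ⟨r', b'⟩
  change Φ (G * Matrix.single r r' 1 * G.conjTranspose) b b' = Φ _ b b'
  refine congrFun (congrFun (congrArg Φ ?_) b) b'
  ext a a'
  simp [Matrix.mul_apply, Matrix.single_apply, ite_and, Matrix.vecMulVec_apply]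

theorem conjMap_one : conjMap (1 : Matrix A A ℂ) = LinearMap.id := by
  refine LinearMap.ext fun M => ?_
  change 1 * M * (1 : Matrix A A ℂ).conjTranspose = M
  simp

theorem isPositiveMap_idTensor {R : Type*} [Fintype R] [DecidableEq R] {Φ : OpMap A B}
    (h : (choi Φ).PosSemidef) : IsPositiveMap (idTensor R Φ) := by
  intro M hM
  -- `V` contracts the two copies of `A` in `M ⊗ choi Φ` against an unnormalised maximally entangled
  -- vector.
  let V : Matrix ((R × A) × (A × B)) (R × B) ℂ :=
    Matrix.of fun x y => if x.1.1 = y.1 ∧ x.2.2 = y.2 ∧ x.1.2 = x.2.1 then 1 else 0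
  have key : idTensor R Φ M = V.conjTranspose * (M ⊗ₖ choi Φ) * V := by
    conv_lhs => rw [← ofChoi_choi Φ]
    ext ⟨r, b⟩ ⟨r', b'⟩
    change ∑ a, ∑ a', M (r, a) (r', a') * choi Φ (a, b) (a', b') = _
    simp only [Matrix.mul_apply, Matrix.conjTranspose_apply, V, Matrix.of_apply,
      Fintype.sum_prod_type, Matrix.kroneckerMap_apply]
    simp [ite_and]
    simp only [apply_ite (starRingEnd ℂ), map_one, map_zero, ite_mul, one_mul, zero_mul]
    simp [Finset.sum_ite_irrel]
    exact Finset.sum_comm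
  rw [key]
  exact (hM.kronecker h).conjTranspose_mul_mul_same V

theorem isCP_iff {Φ : OpMap A B} : IsCP Φ ↔ (choi Φ).PosSemidef := by
  refine ⟨fun h => ?_, fun h => isPositiveMap_idTensor h⟩
  have := h _ (Matrix.posSemidef_vecMulVec_self_star fun p : A × A => (1 : Matrix A A ℂ) p.2 p.1)
  rwa [← choi_comp_conjMap, conjMap_one, LinearMap.comp_id] at this

theorem IsCP.idTensor {R : Type*} [Fintype R] [DecidableEq R] {Φ : OpMap A B} (h : IsCP Φ) :
    IsPositiveMap (MapSimulation.idTensor R Φ) :=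
  isPositiveMap_idTensor (isCP_iff.1 h)

omit [Fintype A] [DecidableEq A] [Fintype B] [DecidableEq B] in
theorem IsPositiveMap.of_idTensor [Inhabited K] {Φ : OpMap A B}
    (h : IsPositiveMap (MapSimulation.idTensor K Φ)) : IsPositiveMap Φ := by
  intro X hX
  exact (h _ (hX.submatrix (Prod.snd : K × A → A))).submatrix (fun b => (default, b))

theorem IsCP.isPositiveMap {Φ : OpMap A B} (h : IsCP Φ) : IsPositiveMap Φ :=
  IsPositiveMap.of_idTensor (h.idTensor (R := Unit))

theorem isCP_zero : IsCP (0 : OpMap A B) := by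
  rw [isCP_iff, map_zero]
  exact .zero

theorem IsCP.add {Φ Ψ : OpMap A B} (hΦ : IsCP Φ) (hΨ : IsCP Ψ) : IsCP (Φ + Ψ) := by
  rw [isCP_iff] at *
  rw [map_add]
  exact hΦ.add hΨ

theorem IsCP.smul {Φ : OpMap A B} (hΦ : IsCP Φ) {r : ℝ} (hr : 0 ≤ r) : IsCP (r • Φ) := by
  rw [isCP_iff] at *
  rw [LinearMap.map_smul_of_tower]
  exact hΦ.smul hr

theorem IsCP.comp_conjMap {Φ : OpMap A B} (hΦ : IsCP Φ) (G : Matrix A A ℂ) :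
    IsCP (Φ ∘ₗ conjMap G) := by
  rw [isCP_iff, choi_comp_conjMap]
  exact hΦ _ (Matrix.posSemidef_vecMulVec_self_star _)

omit [Fintype A] [DecidableEq A] [DecidableEq B] in
theorem trace_idTensor (R : Type*) [Fintype R] (Φ : OpMap A B) (M : Matrix (R × A) (R × A) ℂ) :
    (idTensor R Φ M).trace = ∑ r, (Φ (Matrix.of fun a a' => M (r, a) (r, a'))).trace := by
  simp only [Matrix.trace, Fintype.sum_prod_type]
  rfl

omit [DecidableEq A] [DecidableEq B] in
theorem IsTP.idTensor {R : Type*} [Fintype R] {Φ : OpMap A B} (h : IsTP Φ) :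
    IsTP (MapSimulation.idTensor R Φ) := by
  intro M
  rw [trace_idTensor]
  simp only [h _]
  simp only [Matrix.trace, Fintype.sum_prod_type]
  rfl

omit [DecidableEq A] [DecidableEq B] in
theorem IsTNI.idTensor {R : Type*} [Fintype R] {Φ : OpMap A B} (h : IsTNI Φ) :
    IsTNI (MapSimulation.idTensor R Φ) := by
  intro M hM
  rw [trace_idTensor, Complex.re_sum]
  refine (Finset.sum_le_sum fun r _ => h _ (hM.submatrix fun a => (r, a))).trans_eq ?_
  rw [← Complex.re_sum]
  simp only [Matrix.trace, Fintype.sum_prod_type]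
  rfl

omit [Fintype A] [Fintype B] [DecidableEq B] in
-- `Φ` commutes with the adjoint, as seen by applying the hypothesis to the Hermitian operators `X +
-- Xᴴ` and `i (X - Xᴴ)`.
theorem isHermitian_choi {Φ : OpMap A B} (h : IsHermiticityPreserving Φ) :
    (choi Φ).IsHermitian := by
  have hstar : ∀ X : Matrix A A ℂ, Φ X.conjTranspose = (Φ X).conjTranspose := by
    intro X
    have h1 : (X + X.conjTranspose).IsHermitian := Matrix.isHermitian_add_transpose_self X
    have h2 : (Complex.I • (X - X.conjTranspose)).IsHermitian := by
      rw [Matrix.IsHermitian]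
      simp [Matrix.conjTranspose_smul, ← smul_neg]
    have e1 := (h _ h1).eq
    have e2 := (h _ h2).eq
    simp only [map_add, map_sub, map_smul, Matrix.conjTranspose_add, Matrix.conjTranspose_sub,
      Matrix.conjTranspose_smul] at e1 e2
    ext i j
    have f1 := congrFun (congrFun e1 i) j
    have f2 := congrFun (congrFun e2 i) j
    simp at f1 f2
    have f3 := congrArg (fun z => Complex.I * z) f2
    simp only [← mul_assoc, mul_neg, Complex.I_mul_I, mul_sub] at f3
    simp only [Matrix.conjTranspose_apply, RCLike.star_def]
    linear_combination (-f1 - f3) / 2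
  refine Matrix.IsHermitian.ext fun p q => ?_
  rw [choi_apply, choi_apply, ← Matrix.conjTranspose_apply, ← hstar]
  simp

omit [Fintype B] [DecidableEq B] in
theorem IsHermiticityPreserving.idTensor {R : Type*} {Φ : OpMap A B}
    (h : IsHermiticityPreserving Φ) : IsHermiticityPreserving (MapSimulation.idTensor R Φ) := by
  intro M hM
  have hc := isHermitian_choi h
  rw [← ofChoi_choi Φ]
  refine Matrix.IsHermitian.ext fun p q => ?_
  change star (∑ a, ∑ a', M (q.1, a) (p.1, a') * choi Φ (a, q.2) (a', p.2)) =
    ∑ a, ∑ a', M (p.1, a) (q.1, a') * choi Φ (a, p.2) (a', q.2)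
  rw [Finset.sum_comm]
  simp only [star_sum, star_mul', hM.apply, hc.apply]

end Choi

/-! ### Attainment of the robustness, and its equivalence with the simulation cost. -/

section Robustness
variable {A B K : Type*} [Fintype A] [DecidableEq A] [Fintype B] [DecidableEq B]
  [Fintype K] [DecidableEq K]

omit [Fintype A] [DecidableEq A] [DecidableEq B] in
theorem re_trace_smul_apply (r : ℝ) (Φ : OpMap A B) (X : Matrix A A ℂ) :
    ((r • Φ) X).trace.re = r * (Φ X).trace.re := by
  rw [LinearMap.smul_apply, Matrix.trace_smul, Complex.real_smul, Complex.re_ofReal_mul]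

omit [DecidableEq B] [DecidableEq A] in
theorem mem_robustnessValues_iff {Φ : OpMap A B} {r : ℝ} :
    r ∈ robustnessValues Φ ↔ 0 ≤ r ∧ ∃ Λ Ψ : OpMap A B, IsCPTNI Λ ∧ IsCPTNI Ψ ∧
      (1 + r) • Ψ = Φ + r • Λ := by
  refine and_congr_right fun hr => ?_
  have h1 : (1 + r) ≠ 0 := by positivity
  constructor
  · rintro ⟨Λ, hΛ, h⟩
    exact ⟨Λ, _, hΛ, h, smul_inv_smul₀ h1 _⟩
  · rintro ⟨Λ, Ψ, hΛ, hΨ, h⟩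
    exact ⟨Λ, hΛ, by rwa [← h, inv_smul_smul₀ h1]⟩

omit [DecidableEq B] in
theorem trace_choi (Φ : OpMap A B) : (choi Φ).trace = (Φ 1).trace := by
  have : (1 : Matrix A A ℂ) = ∑ a, Matrix.single a a 1 := by
    ext i j
    simp [Matrix.sum_apply, Matrix.single_apply, Matrix.one_apply, ite_and]
  rw [this, map_sum, Matrix.trace_sum]
  simp only [Matrix.trace, Fintype.sum_prod_type]
  rfl

omit [DecidableEq B] in
/-- The trace of the image of a positive operator is bounded by a multiple of its trace. -/
theorem exists_re_trace_apply_le (Φ : OpMap A B) :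
    ∃ c : ℝ, 0 ≤ c ∧ ∀ X : Matrix A A ℂ, X.PosSemidef → (Φ X).trace.re ≤ c * X.trace.re := by
  refine ⟨∑ a, ∑ a', ‖(Φ (Matrix.single a a' 1)).trace‖,
    Finset.sum_nonneg fun _ _ => Finset.sum_nonneg fun _ _ => norm_nonneg _, fun X hX => ?_⟩
  have h : (Φ X).trace = ∑ a, ∑ a', X a a' * (Φ (Matrix.single a a' 1)).trace := by
    conv_lhs => rw [Matrix.matrix_eq_sum_single X]
    simp only [map_sum, Matrix.trace_sum]
    refine Finset.sum_congr rfl fun a _ => Finset.sum_congr rfl fun a' _ => ?_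
    have : Matrix.single a a' (X a a') = X a a' • Matrix.single a a' (1 : ℂ) := by simp
    rw [this, map_smul, Matrix.trace_smul, smul_eq_mul]
  refine (Complex.re_le_norm _).trans ?_
  rw [h, Finset.sum_mul]
  refine (norm_sum_le _ _).trans (Finset.sum_le_sum fun a _ => ?_)
  rw [Finset.sum_mul]
  refine (norm_sum_le _ _).trans (Finset.sum_le_sum fun a' _ => ?_)
  rw [norm_mul, mul_comm]
  exact mul_le_mul_of_nonneg_left (norm_apply_le_re_trace hX a a') (norm_nonneg _)

theorem robustnessValues_nonempty {Φ : OpMap A B} (hΦ : IsHermiticityPreserving Φ) :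
    (robustnessValues Φ).Nonempty := by
  obtain ⟨P, N, hP, hN, h, -⟩ := exists_posSemidef_sub_eq (isHermitian_choi hΦ)
  obtain ⟨c₁, hc₁, h₁⟩ := exists_re_trace_apply_le (ofChoi P)
  obtain ⟨c₂, hc₂, h₂⟩ := exists_re_trace_apply_le (ofChoi N)
  have hcp : IsCP (ofChoi P) := by rwa [isCP_iff, choi_ofChoi]
  have hcn : IsCP (ofChoi N) := by rwa [isCP_iff, choi_ofChoi]
  have hr : 0 < 1 + c₁ + c₂ := by positivity
  -- Any `r > 0` with `c₂ ≤ r` and `c₁ ≤ 1 + r` makes both rescaled Jordan parts of `Φ`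
  -- trace-non-increasing.
  refine ⟨1 + c₁ + c₂, mem_robustnessValues_iff.2 ⟨hr.le, (1 + c₁ + c₂)⁻¹ • ofChoi N,
    (1 + (1 + c₁ + c₂))⁻¹ • ofChoi P, ⟨hcn.smul (by positivity), fun X hX => ?_⟩,
    ⟨hcp.smul (by positivity), fun X hX => ?_⟩, ?_⟩⟩
  · have := re_trace_nonneg hX
    rw [re_trace_smul_apply, inv_mul_le_iff₀ hr]
    nlinarith [h₂ X hX]
  · have := re_trace_nonneg hX
    rw [re_trace_smul_apply, inv_mul_le_iff₀ (by positivity)]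
    nlinarith [h₁ X hX]
  · rw [smul_inv_smul₀ hr.ne', smul_inv_smul₀ (by positivity)]
    have e : choi Φ + choi (ofChoi N) = choi (ofChoi P) := by
      rw [choi_ofChoi, choi_ofChoi, h, sub_add_cancel]
    rw [← map_add] at e
    rw [← ofChoi_choi (Φ + ofChoi N), e, choi_ofChoi]

omit [DecidableEq A] [DecidableEq B] in
theorem continuous_re_trace_ofChoi (X : Matrix A A ℂ) :
    Continuous fun J : Matrix (A × B) (A × B) ℂ => (ofChoi J X).trace.re := by
  simp only [Matrix.trace, Matrix.diag, ofChoi_apply]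
  fun_prop

theorem isLeast_robustness {Φ : OpMap A B} (hΦ : IsHermiticityPreserving Φ) :
    IsLeast (robustnessValues Φ) (robustness Φ) := by
  obtain ⟨r₀, hr₀⟩ := robustnessValues_nonempty hΦ
  -- Pairs of a value `r` and a Choi matrix of `Λ`. The bound `r ≤ r₀` and `Tr (choi Λ) = Tr Λ(1) ≤
  -- |A|` give compactness; the conditions on the mixture, multiplied by `1 + r`, are visibly
  -- closed.
  let T : Set (ℝ × Matrix (A × B) (A × B) ℂ) :=
    {x | x.1 ∈ Set.Icc 0 r₀ ∧ x.2 ∈ {P | P.PosSemidef ∧ P.trace.re ≤ (Fintype.card A : ℝ)}} ∩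
    ({x | ∀ X : Matrix A A ℂ, X.PosSemidef → (ofChoi x.2 X).trace.re ≤ X.trace.re} ∩
    ({x | (choi Φ + x.1 • x.2).PosSemidef} ∩
    {x | ∀ X : Matrix A A ℂ, X.PosSemidef →
      (Φ X).trace.re + x.1 * (ofChoi x.2 X).trace.re ≤ (1 + x.1) * X.trace.re}))
  have hT : IsCompact T := by
    refine (isCompact_Icc.prod (isCompact_posSemidef_trace_le _)).inter_right ?_
    refine .inter ?_ (.inter ?_ ?_)
    · simp only [Set.ofPred_forall]
      exact isClosed_iInter fun X => isClosed_iInter fun _ =>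
        isClosed_le ((continuous_re_trace_ofChoi X).comp continuous_snd) continuous_const
    · exact isClosed_posSemidef.preimage
        (f := fun x : ℝ × Matrix (A × B) (A × B) ℂ => choi Φ + x.1 • x.2) (by fun_prop)
    · simp only [Set.ofPred_forall]
      exact isClosed_iInter fun X => isClosed_iInter fun _ =>
        isClosed_le (continuous_const.add
          (continuous_fst.mul ((continuous_re_trace_ofChoi X).comp continuous_snd))) (by fun_prop)
  have hmem : ∀ r, r ≤ r₀ → (r ∈ robustnessValues Φ ↔ r ∈ Prod.fst '' T) := by
    intro r hr
    constructor
    · intro h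
      have h0 := h.1
      have h1 : 0 < 1 + r := by positivity
      obtain ⟨Λ, hΛ, hΨ⟩ := h.2
      refine ⟨(r, choi Λ), ⟨⟨⟨h0, hr⟩, isCP_iff.1 hΛ.1, ?_⟩, ?_, ?_, ?_⟩, rfl⟩
      · rw [trace_choi]
        simpa using hΛ.2 1 .one
      · intro X hX
        simpa using hΛ.2 X hX
      · have := isCP_iff.1 (hΨ.1.smul h1.le)
        rw [smul_inv_smul₀ h1.ne', map_add, LinearMap.map_smul_of_tower] at this
        exact this
      · intro X hX
        have := hΨ.2 X hX
        rw [re_trace_smul_apply, inv_mul_le_iff₀ h1, LinearMap.add_apply, Matrix.trace_add,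
          Complex.add_re, re_trace_smul_apply] at this
        simpa using this
    · rintro ⟨⟨r, J⟩, ⟨⟨hr', hJ, -⟩, h2, h3, h4⟩, rfl⟩
      have h0 : 0 ≤ r := hr'.1
      have h1 : 0 < 1 + r := by positivity
      refine ⟨h0, ofChoi J, ⟨by rwa [isCP_iff, choi_ofChoi], h2⟩, ?_, ?_⟩
      · refine IsCP.smul ?_ (by positivity)
        rw [isCP_iff, map_add, LinearMap.map_smul_of_tower, choi_ofChoi]
        exact h3
      · intro X hX
        rw [re_trace_smul_apply, inv_mul_le_iff₀ h1, LinearMap.add_apply, Matrix.trace_add,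
          Complex.add_re, re_trace_smul_apply]
        exact h4 X hX
  have hTne : (Prod.fst '' T).Nonempty := ⟨r₀, (hmem r₀ le_rfl).1 hr₀⟩
  obtain ⟨r, hr, hmin⟩ := (hT.image continuous_fst).exists_isLeast hTne
  have hrr₀ : r ≤ r₀ := hmin ((hmem r₀ le_rfl).1 hr₀)
  have hleast : IsLeast (robustnessValues Φ) r := by
    refine ⟨(hmem r hrr₀).2 hr, fun s hs => ?_⟩
    rcases le_total s r₀ with h | h
    · exact hmin ((hmem s h).1 hs)
    · exact hrr₀.trans h
  rwa [robustness, hleast.csInf_eq]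

/-- The map `ρ ↦ ρ ⊗ X`. -/
def kroneckerRight (A : Type*) (X : Matrix K K ℂ) : OpMap A (A × K) where
  toFun ρ := ρ ⊗ₖ X
  map_add' _ _ := Matrix.add_kronecker _ _ _
  map_smul' _ _ := Matrix.smul_kronecker _ _ _

theorem IsCP.comp_kroneckerRight {Λ : OpMap (A × K) B} (h : IsCP Λ) {X : Matrix K K ℂ}
    (hX : X.PosSemidef) : IsCP (Λ ∘ₗ kroneckerRight A X) := fun _ hM =>
  h.idTensor (R := A) _
    ((hM.kronecker hX).submatrix fun p : A × (A × K) => ((p.1, p.2.1), p.2.2))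

/-- `Ψ` is the right-hand side divided by `Tr X`. If `Tr X = 0` then `X = 0`, and `Ψ = 0` serves. -/
theorem IsCPTNI.exists_smul_eq_comp_kroneckerRight {Λ : OpMap (A × K) B} (h : IsCPTNI Λ)
    {X : Matrix K K ℂ} (hX : X.PosSemidef) :
    ∃ Ψ : OpMap A B, IsCPTNI Ψ ∧ X.trace.re • Ψ = Λ ∘ₗ kroneckerRight A X := by
  have h0 := re_trace_nonneg hX
  have hc : (X.trace.re : ℂ) = X.trace := 
    Complex.ext (by simp) (by simpa using (Complex.nonneg_iff.1 hX.trace_nonneg).2)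
  rcases h0.eq_or_lt with ht | ht
  · have : X = 0 := by
      rw [← hX.trace_eq_zero_iff, ← hc, ← ht, Complex.ofReal_zero]
    subst this
    refine ⟨0, ⟨isCP_zero, fun Y hY => by simpa using re_trace_nonneg hY⟩, ?_⟩
    refine LinearMap.ext fun Y => ?_
    change _ = Λ (Y ⊗ₖ (0 : Matrix K K ℂ))
    simp
  · refine ⟨X.trace.re⁻¹ • (Λ ∘ₗ kroneckerRight A X),
      ⟨(h.1.comp_kroneckerRight hX).smul (by positivity), fun Y hY => ?_⟩,
      smul_inv_smul₀ ht.ne' _⟩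
    rw [re_trace_smul_apply, inv_mul_le_iff₀ ht]
    refine (h.2 _ (hY.kronecker hX)).trans_eq ?_
    rw [Matrix.trace_kronecker, mul_comm, ← hc, Complex.re_ofReal_mul, Complex.ofReal_re]

theorem Simulates.exists_mem_robustnessValues {Φ : OpMap A B} {Λ : OpMap (A × K) B}
    {X : Matrix K K ℂ} (hΛ : IsCPTNI Λ) (h : Simulates Φ Λ X) :
    ∃ r ∈ robustnessValues Φ, traceNorm X = 2 * r + 1 := by
  obtain ⟨hX, htr, hsim⟩ := h
  obtain ⟨P, N, hP, hN, rfl, hnorm⟩ := exists_posSemidef_sub_eq hX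
  have hre := congrArg Complex.re htr
  rw [Matrix.trace_sub, Complex.sub_re, Complex.one_re] at hre
  obtain ⟨Ψ, hΨ, eΨ⟩ := hΛ.exists_smul_eq_comp_kroneckerRight hP
  obtain ⟨Λ', hΛ', eΛ'⟩ := hΛ.exists_smul_eq_comp_kroneckerRight hN
  refine ⟨N.trace.re, mem_robustnessValues_iff.2
    ⟨re_trace_nonneg hN, Λ', Ψ, hΛ', hΨ, ?_⟩, by linarith⟩
  rw [show 1 + N.trace.re = P.trace.re by linarith, eΨ, eΛ']
  refine LinearMap.ext fun ρ => ?_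
  change Λ (ρ ⊗ₖ P) = Φ ρ + Λ (ρ ⊗ₖ N)
  rw [← hsim, ← map_add, ← Matrix.kronecker_add, sub_add_cancel]

/-- The map that applies `Λ k` to the `k`-th diagonal block and sums the results. -/
def blockSum (Λ : K → OpMap A B) : OpMap (A × K) B where
  toFun M := ∑ k, Λ k (M.submatrix (fun a => (a, k)) (fun a => (a, k)))
  map_add' M N := by simp [Matrix.submatrix_add, Finset.sum_add_distrib]
  map_smul' c M := by simp [Matrix.submatrix_smul, Finset.smul_sum]

theorem isCP_blockSum {Λ : K → OpMap A B} (h : ∀ k, IsCP (Λ k)) : IsCP (blockSum Λ) := by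
  intro M hM
  have key : idTensor (A × K) (blockSum Λ) M = ∑ k, idTensor (A × K) (Λ k)
      (M.submatrix (fun p : (A × K) × A => (p.1, (p.2, k)))
        (fun p : (A × K) × A => (p.1, (p.2, k)))) := by
    ext p q
    rw [Matrix.sum_apply]
    exact Matrix.sum_apply _ _ _ _
  rw [key]
  exact Matrix.posSemidef_sum _ fun k _ => (h k).idTensor _ (hM.submatrix _)

omit [DecidableEq A] [DecidableEq B] [DecidableEq K] in
theorem trace_eq_sum_trace_submatrix (M : Matrix (A × K) (A × K) ℂ) :
    M.trace = ∑ k, (M.submatrix (fun a => (a, k)) (fun a => (a, k))).trace := by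
  simp only [Matrix.trace, Fintype.sum_prod_type]
  exact Finset.sum_comm

omit [DecidableEq A] [DecidableEq B] [DecidableEq K] in
theorem isTNI_blockSum {Λ : K → OpMap A B} (h : ∀ k, IsTNI (Λ k)) : IsTNI (blockSum Λ) := by
  intro M hM
  rw [trace_eq_sum_trace_submatrix]
  change (∑ k, Λ k _).trace.re ≤ _
  rw [Matrix.trace_sum, Complex.re_sum, Complex.re_sum]
  exact Finset.sum_le_sum fun k _ => h k _ (hM.submatrix _)

omit [DecidableEq A] [DecidableEq B] [DecidableEq K] in
theorem isTP_blockSum {Λ : K → OpMap A B} (h : ∀ k, IsTP (Λ k)) : IsTP (blockSum Λ) := by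
  intro M
  rw [trace_eq_sum_trace_submatrix]
  change (∑ k, Λ k _).trace = _
  rw [Matrix.trace_sum]
  exact Finset.sum_congr rfl fun k _ => h k _

omit [Fintype A] [DecidableEq A] [Fintype B] [DecidableEq B] in
-- The diagonal blocks of `ρ ⊗ X` are `(1 + r) ρ` at `k₀`, `-r ρ` at `k₁` and zero elsewhere, so the
-- remaining ancilla levels contribute nothing.
theorem simulates_blockSum {Φ Λ Ψ : OpMap A B} {r : ℝ} (h : (1 + r) • Ψ = Φ + r • Λ)
    {k₀ k₁ : K} (hk : k₀ ≠ k₁) :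
    Simulates Φ (blockSum fun k => if k = k₀ then Ψ else Λ)
      ((1 + r) • Matrix.single k₀ k₀ 1 - r • Matrix.single k₁ k₁ 1) := by
  refine ⟨?_, ?_, fun ρ => ?_⟩
  · simp [Matrix.IsHermitian]
  · simp [Matrix.trace_sub]
  · change ∑ k, (if k = k₀ then Ψ else Λ) _ = _
    have hblock : ∀ k, (ρ ⊗ₖ ((1 + r) • Matrix.single k₀ k₀ (1 : ℂ) -
        r • Matrix.single k₁ k₁ 1)).submatrix (fun a => (a, k)) (fun a => (a, k)) =
        ((if k = k₀ then 1 + r else 0) - (if k = k₁ then r else 0) : ℝ) • ρ := by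
      intro k
      ext a a'
      rcases eq_or_ne k k₀ with rfl | h₀
      · simp [hk, hk.symm, mul_comm]
      · rcases eq_or_ne k k₁ with rfl | h₁
        · simp [hk, hk.symm, mul_comm]
        · simp [h₀, h₁, h₀.symm, h₁.symm]
    simp only [hblock, LinearMap.map_smul_of_tower]
    rw [← Finset.add_sum_erase _ _ (Finset.mem_univ k₀),
      ← Finset.add_sum_erase _ _ (Finset.mem_erase.2 ⟨hk.symm, Finset.mem_univ k₁⟩),
      Finset.sum_eq_zero]
    · have := LinearMap.congr_fun h ρ
      simp only [LinearMap.smul_apply, LinearMap.add_apply] at this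
      simp [hk, hk.symm, this]
    · intro k hk'
      simp only [Finset.mem_erase] at hk'
      simp [hk'.1, hk'.2.1]

omit [DecidableEq A] [DecidableEq B] in
theorem traceNorm_single_sub_single_le {r : ℝ} (hr : 0 ≤ r) (k₀ k₁ : K) :
    traceNorm ((1 + r) • Matrix.single k₀ k₀ (1 : ℂ) - r • Matrix.single k₁ k₁ 1) ≤ 2 * r + 1 := by
  have hs : ∀ k : K, (Matrix.single k k (1 : ℂ)).PosSemidef := fun k => by
    rw [← Matrix.diagonal_single]
    exact .diagonal (by simp)
  refine (traceNorm_sub_le ((hs k₀).smul (by positivity)) ((hs k₁).smul hr)).trans_eq ?_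
  simp
  ring

theorem two_mul_robustness_add_one_le {Φ : OpMap A B} (hΦ : IsHermiticityPreserving Φ)
    {Λ : OpMap (A × K) B} {X : Matrix K K ℂ} (hΛ : IsCPTNI Λ) (h : Simulates Φ Λ X) :
    2 * robustness Φ + 1 ≤ traceNorm X := by
  obtain ⟨r, hr, h⟩ := h.exists_mem_robustnessValues hΛ
  rw [h]
  linarith [(isLeast_robustness hΦ).2 hr]

/-- The explicit `X` costs at most `2 R + 1`, and no simulation costs less, so its norm need not be
computed. -/
theorem exists_simulates_traceNorm_eq {Φ : OpMap A B} (hΦ : IsHermiticityPreserving Φ)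
    {Λ Ψ : OpMap A B} (hΛ : IsCPTNI Λ) (hΨ : IsCPTNI Ψ)
    (h : (1 + robustness Φ) • Ψ = Φ + robustness Φ • Λ) {k₀ k₁ : K} (hk : k₀ ≠ k₁) :
    ∃ X : Matrix K K ℂ, Simulates Φ (blockSum fun k => if k = k₀ then Ψ else Λ) X ∧
      traceNorm X = 2 * robustness Φ + 1 := by
  refine ⟨_, simulates_blockSum h hk, le_antisymm
    (traceNorm_single_sub_single_le (isLeast_robustness hΦ).1.1 k₀ k₁)
    (two_mul_robustness_add_one_le hΦ ⟨isCP_blockSum fun k => ?_, isTNI_blockSum fun k => ?_⟩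
      (simulates_blockSum h hk))⟩
  · split_ifs
    exacts [hΨ.1, hΛ.1]
  · split_ifs
    exacts [hΨ.2, hΛ.2]

theorem isLeast_simulationCostsOn {Φ : OpMap A B} (hΦ : IsHermiticityPreserving Φ)
    {d : ℕ} (hd : 2 ≤ d) :
    IsLeast (simulationCostsOn (Fin d) Φ) (2 * robustness Φ + 1) := by
  constructor
  · obtain ⟨-, Λ, Ψ, hΛ, hΨ, h⟩ := mem_robustnessValues_iff.1 (isLeast_robustness hΦ).1
    have hk : (⟨0, by lia⟩ : Fin d) ≠ ⟨1, by lia⟩ := by simp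
    obtain ⟨X, hX, hnorm⟩ := exists_simulates_traceNorm_eq hΦ hΛ hΨ h hk
    refine ⟨_, X, ⟨isCP_blockSum fun k => ?_, isTNI_blockSum fun k => ?_⟩, hX, hnorm.symm⟩
    · split_ifs
      exacts [hΨ.1, hΛ.1]
    · split_ifs
      exacts [hΨ.2, hΛ.2]
  · rintro c ⟨Λ, X, hΛ, hsim, rfl⟩
    exact two_mul_robustness_add_one_le hΦ hΛ hsim

theorem isLeast_simulationCosts {Φ : OpMap A B} (hΦ : IsHermiticityPreserving Φ) :
    IsLeast (simulationCosts Φ) (2 * robustness Φ + 1) := by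
  constructor
  · exact Set.mem_iUnion.2 ⟨2, (isLeast_simulationCostsOn hΦ le_rfl).1⟩
  · rintro c hc
    obtain ⟨d, Λ, X, hΛ, hsim, rfl⟩ := Set.mem_iUnion.1 hc
    exact two_mul_robustness_add_one_le hΦ hΛ hsim

theorem simulationCost_eq {Φ : OpMap A B} (hΦ : IsHermiticityPreserving Φ) :
    simulationCost Φ = 2 * robustness Φ + 1 :=
  (isLeast_simulationCosts hΦ).csInf_eq

end Robustness

/-! ### Completion to trace-preserving maps, and the upper bound on the diamond norm. -/

section Diamond
variable {A B : Type*} [Fintype A] [DecidableEq A] [Fintype B] [DecidableEq B]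

/-- The map that sends the trace missing from the output of `Λ` to a fixed operator `σ`. Adding it
to `Λ` restores the trace when `σ` has unit trace. -/
def traceDefect (Λ : OpMap A B) (σ : Matrix B B ℂ) : OpMap A B where
  toFun M := (M.trace - (Λ M).trace) • σ
  map_add' M N := by
    rw [map_add, Matrix.trace_add, Matrix.trace_add, ← add_smul]
    congr 1
    ring
  map_smul' c M := by
    rw [map_smul, Matrix.trace_smul, Matrix.trace_smul, ← smul_sub, smul_assoc]
    rfl

omit [DecidableEq A] [DecidableEq B] in
theorem trace_traceDefect (Λ : OpMap A B) {σ : Matrix B B ℂ} (hσ : σ.trace = 1)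
    (M : Matrix A A ℂ) : (traceDefect Λ σ M).trace = M.trace - (Λ M).trace := by
  change ((M.trace - (Λ M).trace) • σ).trace = _
  rw [Matrix.trace_smul, hσ, smul_eq_mul, mul_one]

/-- The Choi matrix is `L ⊗ σ`, where `L` represents the functional `ℓ = Tr - Tr ∘ Λ`. The quadratic
form of `L` at `x` is `ℓ` evaluated at the rank-one projector onto the conjugate of `x`, up to
scale, hence nonnegative. -/
theorem isCP_traceDefect {Λ : OpMap A B} (hΛ : IsCPTNI Λ) {σ : Matrix B B ℂ}
    (hσ : σ.PosSemidef) : IsCP (traceDefect Λ σ) := by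
  let ℓ : Matrix A A ℂ → ℂ := fun M => M.trace - (Λ M).trace
  have hℓ : ∀ M : Matrix A A ℂ, M.PosSemidef → 0 ≤ ℓ M := by
    intro M hM
    have hΛM := (hΛ.1.isPositiveMap M hM).trace_nonneg
    rw [Complex.nonneg_iff]
    refine ⟨sub_nonneg.2 (hΛ.2 M hM), ?_⟩
    rw [Complex.sub_im, ← (Complex.nonneg_iff.1 hM.trace_nonneg).2,
      ← (Complex.nonneg_iff.1 hΛM).2, sub_zero]
  rw [isCP_iff]
  let L : Matrix A A ℂ := Matrix.of fun a a' => ℓ (Matrix.single a a' 1)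
  have hquad : ∀ x : A → ℂ,
      dotProduct (star x) (L.mulVec x) = ℓ (Matrix.vecMulVec (star x) (star (star x))) := by
    intro x
    have : Matrix.vecMulVec (star x) (star (star x)) =
        ∑ a, ∑ a', (star x a * x a') • Matrix.single a a' (1 : ℂ) := by
      rw [Matrix.matrix_eq_sum_single (Matrix.vecMulVec (star x) (star (star x)))]
      simp [Matrix.vecMulVec_apply]
    simp only [ℓ]
    rw [this]
    simp only [map_sum, map_smul, Matrix.trace_sum, Matrix.trace_smul, ← Finset.sum_sub_distrib,
      ← smul_sub]
    simp only [dotProduct, Matrix.mulVec, L, ℓ, Matrix.of_apply, Finset.mul_sum, smul_eq_mul]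
    refine Finset.sum_congr rfl fun a _ => Finset.sum_congr rfl fun a' _ => ?_
    ring
  have hL : L.PosSemidef := by
    refine Matrix.PosSemidef.of_dotProduct_mulVec_nonneg ?_ fun x => ?_
    · refine Matrix.IsHermitian.ext fun a a' => ?_
      have hJ := (isCP_iff.1 hΛ.1).isHermitian
      change star ((Matrix.single a' a 1).trace - ∑ b, choi Λ (a', b) (a, b)) =
        (Matrix.single a a' 1).trace - ∑ b, choi Λ (a, b) (a', b)
      simp only [star_sub, star_sum, hJ.apply]
      rw [← Matrix.trace_conjTranspose, Matrix.conjTranspose_single, star_one]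
    · rw [hquad]
      exact hℓ _ (Matrix.posSemidef_vecMulVec_self_star _)
  exact hL.kronecker hσ

/-- Adding the defect map `D` of `Λ` to `Λ`, and `r / (1 + r) • D` to `Ψ`, keeps the identity. The
right-hand side then scales every trace by `1 + r`, which forces the new `Ψ` to preserve it. -/
theorem exists_isCPTP_of_isTP {Φ Λ Ψ : OpMap A B} [Nonempty A] (hΦ : IsTP Φ) {r : ℝ} (hr : 0 ≤ r)
    (hΛ : IsCPTNI Λ) (hΨ : IsCPTNI Ψ) (h : (1 + r) • Ψ = Φ + r • Λ) :
    ∃ Λ' Ψ' : OpMap A B, IsCPTP Λ' ∧ IsCPTP Ψ' ∧ (1 + r) • Ψ' = Φ + r • Λ' := by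
  have hB : Nonempty B := by
    by_contra hB
    rw [not_nonempty_iff] at hB
    have := hΦ 1
    rw [Matrix.trace_one] at this
    simp [Matrix.trace] at this
    exact (Nat.cast_ne_zero.2 Fintype.card_ne_zero) this.symm
  obtain ⟨b⟩ := hB
  have hσ : (Matrix.single b b (1 : ℂ)).PosSemidef := by
    rw [← Matrix.diagonal_single]
    exact .diagonal (by simp)
  have hσ' : (Matrix.single b b (1 : ℂ)).trace = 1 := by simp
  have h1 : (1 + r) ≠ 0 := by positivity
  set D := traceDefect Λ (Matrix.single b b (1 : ℂ)) with hD
  have hDcp : IsCP D := isCP_traceDefect hΛ hσ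
  have hΨ' : (1 + r) • (Ψ + (r / (1 + r)) • D) = Φ + r • (Λ + D) := by
    rw [smul_add, h, smul_smul, mul_div_cancel₀ _ h1, smul_add, add_assoc]
  have hΛtp : IsTP (Λ + D) := fun M => by
    rw [LinearMap.add_apply, Matrix.trace_add, hD, trace_traceDefect Λ hσ']
    ring
  refine ⟨Λ + D, Ψ + (r / (1 + r)) • D, ⟨hΛ.1.add hDcp, hΛtp⟩,
    ⟨hΨ.1.add (hDcp.smul (by positivity)), fun M => ?_⟩, hΨ'⟩
  have := congrArg Matrix.trace (LinearMap.congr_fun hΨ' M)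
  rw [LinearMap.smul_apply, LinearMap.add_apply Φ, LinearMap.smul_apply, Matrix.trace_smul,
    Matrix.trace_add, Matrix.trace_smul, hΛtp, hΦ] at this
  have e : M.trace + r • M.trace = (1 + r) • M.trace := by rw [add_smul, one_smul]
  rw [e] at this
  exact smul_right_injective ℂ h1 this

theorem traceNorm_idTensor_le {Φ : OpMap A B} {r : ℝ} (hr : r ∈ robustnessValues Φ)
    {ρ : Matrix (A × A) (A × A) ℂ} (hρ : IsDensity ρ) :
    traceNorm (idTensor A Φ ρ) ≤ 2 * r + 1 := by
  obtain ⟨h0, Λ, Ψ, hΛ, hΨ, h⟩ := mem_robustnessValues_iff.1 hr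
  have e : idTensor A Φ ρ = (1 + r) • idTensor A Ψ ρ - r • idTensor A Λ ρ := by
    rw [eq_sub_iff_add_eq]
    ext p q
    exact (congrFun (congrFun (LinearMap.congr_fun h
      (Matrix.of fun a a' => ρ (p.1, a) (q.1, a'))) p.2) q.2).symm
  rw [e]
  refine (traceNorm_sub_le ((hΨ.1 _ hρ.1).smul (by positivity))
    ((hΛ.1 _ hρ.1).smul h0)).trans ?_
  have h1 := hΨ.2.idTensor (R := A) _ hρ.1
  have h2 := hΛ.2.idTensor (R := A) _ hρ.1
  rw [hρ.2, Complex.one_re] at h1 h2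
  rw [Matrix.trace_smul, Matrix.trace_smul, Complex.real_smul, Complex.real_smul,
    Complex.re_ofReal_mul, Complex.re_ofReal_mul]
  nlinarith

theorem isDensity_inv_card_smul_one [Nonempty A] :
    IsDensity ((Fintype.card A : ℝ)⁻¹ • (1 : Matrix A A ℂ)) := by
  refine ⟨Matrix.PosSemidef.one.smul (by positivity), ?_⟩
  rw [Matrix.trace_smul, Matrix.trace_one]
  simp

omit [DecidableEq A] [Fintype B] [DecidableEq B] in
theorem continuous_idTensor (Φ : OpMap A B) : Continuous (idTensor A Φ) :=
  LinearMap.continuous_of_finiteDimensional (idTensor A Φ)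

theorem isGreatest_diamondNorm [Nonempty A] (Φ : OpMap A B) :
    IsGreatest (diamondValues Φ) (diamondNorm Φ) := by
  have hc : IsCompact (diamondValues Φ) := by
    have := (isCompact_density (n := A × A)).image
      (continuous_traceNorm.comp (continuous_idTensor Φ))
    convert this using 1
    ext c
    exact exists_congr fun ρ => and_congr_right fun _ => eq_comm
  exact hc.isGreatest_sSup ⟨_, _, isDensity_inv_card_smul_one, rfl⟩

end Diamond

/-! ### The lower bound on the diamond norm, by minimax. -/

section Duality
variable {A B : Type*} [Fintype A] [DecidableEq A] [Fintype B] [DecidableEq B]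

theorem posSemidef_choi_comp_conjMap {J : Matrix (A × B) (A × B) ℂ} (hJ : J.PosSemidef)
    (G : Matrix A A ℂ) : (choi (ofChoi J ∘ₗ conjMap G)).PosSemidef := by
  rw [← isCP_iff]
  refine IsCP.comp_conjMap ?_ G
  rwa [isCP_iff, choi_ofChoi]

omit [DecidableEq A] [Fintype B] [DecidableEq B] in
theorem ofChoi_add (J L : Matrix (A × B) (A × B) ℂ) : ofChoi (J + L) = ofChoi J + ofChoi L := by
  refine LinearMap.ext fun M => ?_
  ext b b'
  simp [ofChoi_apply, mul_add, Finset.sum_add_distrib]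

omit [DecidableEq A] [Fintype B] [DecidableEq B] in
theorem ofChoi_smul (r : ℝ) (J : Matrix (A × B) (A × B) ℂ) :
    ofChoi (r • J) = r • ofChoi J := by
  refine LinearMap.ext fun M => ?_
  ext b b'
  simp [ofChoi_apply, Finset.mul_sum, mul_left_comm]

/-- A trace-preserving map is dominated by a completely positive one whose output at a given
faithful state has trace at most `(‖Φ‖_⋄ + 1) / 2`. -/
theorem exists_posSemidef_re_trace_le_of_posDef [Nonempty A] {Φ : OpMap A B}
    (hΦ : IsHermiticityPreserving Φ) (hTP : IsTP Φ) {σ : Matrix A A ℂ} (hσ : σ.PosDef)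
    (htr : σ.trace = 1) :
    ∃ P : Matrix (A × B) (A × B) ℂ, P.PosSemidef ∧ (P - choi Φ).PosSemidef ∧
      (ofChoi P σ).trace.re ≤ (diamondNorm Φ + 1) / 2 := by
  obtain ⟨G, rfl⟩ : ∃ G : Matrix A A ℂ, σ = G * G.conjTranspose := by
    obtain ⟨C, hC⟩ := CStarAlgebra.nonneg_iff_eq_star_mul_self.mp hσ.posSemidef.nonneg
    exact ⟨star C, by rw [hC, Matrix.star_eq_conjTranspose, Matrix.conjTranspose_conjTranspose]⟩
  have hG : IsUnit G := by
    have := (Matrix.isUnit_iff_isUnit_det _).1 hσ.isUnit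
    rw [Matrix.det_mul] at this
    exact (Matrix.isUnit_iff_isUnit_det _).2 (isUnit_of_mul_isUnit_left this)
  have hGdet := (Matrix.isUnit_iff_isUnit_det G).1 hG
  set v : A × A → ℂ := fun p => G p.2 p.1
  have hρ : IsDensity (Matrix.vecMulVec v (star v)) := by
    refine ⟨Matrix.posSemidef_vecMulVec_self_star v, ?_⟩
    rw [← htr, Matrix.trace_vecMulVec]
    simp only [Matrix.trace, Matrix.diag, Matrix.mul_apply, dotProduct, Fintype.sum_prod_type]
    exact Finset.sum_comm
  obtain ⟨P, N, hP, hN, hH, hnorm⟩ :=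
    exists_posSemidef_sub_eq (hΦ.idTensor (R := A) _ hρ.1.isHermitian)
  have hle : P.trace.re + N.trace.re ≤ diamondNorm Φ :=
    hnorm ▸ (isGreatest_diamondNorm Φ).2 ⟨_, hρ, rfl⟩
  -- Together with the bound on the sum, this gives `Tr P ≤ (‖Φ‖_⋄ + 1) / 2`.
  have hsub : P.trace.re - N.trace.re = 1 := by
    rw [← Complex.sub_re, ← Matrix.trace_sub, ← hH, hTP.idTensor, hρ.2, Complex.one_re]
  rw [← choi_comp_conjMap] at hH
  have hcancel : conjMap G ∘ₗ conjMap G⁻¹ = LinearMap.id := by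
    refine LinearMap.ext fun M => ?_
    change G * (G⁻¹ * M * G⁻¹.conjTranspose) * G.conjTranspose = M
    rw [Matrix.mul_assoc, Matrix.mul_assoc, ← Matrix.conjTranspose_mul,
      Matrix.mul_nonsing_inv _ hGdet, Matrix.conjTranspose_one, Matrix.mul_one,
      Matrix.mul_nonsing_inv_cancel_left _ _ hGdet]
  -- Undoing `G` preserves positivity, turns `P - N` back into `choi Φ`, and makes the output trace
  -- at `G Gᴴ` equal to `Tr P`.
  refine ⟨choi (ofChoi P ∘ₗ conjMap G⁻¹), posSemidef_choi_comp_conjMap hP _, ?_, ?_⟩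
  · have e : choi (ofChoi P ∘ₗ conjMap G⁻¹) - choi Φ = choi (ofChoi N ∘ₗ conjMap G⁻¹) := by
      have : ofChoi P = Φ ∘ₗ conjMap G + ofChoi N := by
        rw [← ofChoi_choi (Φ ∘ₗ conjMap G), ← ofChoi_add, hH, sub_add_cancel]
      rw [this, LinearMap.add_comp, LinearMap.comp_assoc, hcancel, LinearMap.comp_id, map_add,
        add_sub_cancel_left]
    rw [e]
    exact posSemidef_choi_comp_conjMap hN _
  · rw [ofChoi_choi]
    have e : conjMap G⁻¹ (G * G.conjTranspose) = 1 := by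
      change G⁻¹ * (G * G.conjTranspose) * G⁻¹.conjTranspose = 1
      rw [Matrix.nonsing_inv_mul_cancel_left _ _ hGdet, ← Matrix.conjTranspose_mul,
        Matrix.nonsing_inv_mul _ hGdet, Matrix.conjTranspose_one]
    rw [LinearMap.comp_apply, e, ← trace_choi, choi_ofChoi]
    linarith

theorem re_trace_ofChoi_nonneg {P : Matrix (A × B) (A × B) ℂ} (hP : P.PosSemidef)
    {X : Matrix A A ℂ} (hX : X.PosSemidef) : 0 ≤ (ofChoi P X).trace.re := by
  have : IsCP (ofChoi P) := by rwa [isCP_iff, choi_ofChoi]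
  exact re_trace_nonneg (this.isPositiveMap X hX)

/-- The minimax step: one dominating completely positive map serves all the states `σ ≥ δ`. -/
theorem exists_posSemidef_forall_re_trace_le [Nonempty A] {Φ : OpMap A B}
    (hΦ : IsHermiticityPreserving Φ) (hTP : IsTP Φ) {δ : ℝ} (hδ : 0 < δ)
    (hδ' : δ ≤ (Fintype.card A : ℝ)⁻¹) :
    ∃ P : Matrix (A × B) (A × B) ℂ, P.PosSemidef ∧ (P - choi Φ).PosSemidef ∧
      ∀ σ : Matrix A A ℂ, (σ - δ • (1 : Matrix A A ℂ)).PosSemidef → σ.trace = 1 →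
        (ofChoi P σ).trace.re ≤ (diamondNorm Φ + 1) / 2 := by
  set c := (diamondNorm Φ + 1) / 2
  -- The cutoff `c / δ` costs nothing: for `σ ≥ δ`, `δ Tr P` is at most the output trace at `σ`,
  -- which is at most `c`.
  let X : Set (Matrix (A × B) (A × B) ℂ) :=
    {P | P.PosSemidef ∧ P.trace.re ≤ c / δ} ∩ {P | (P - choi Φ).PosSemidef}
  let Y : Set (Matrix A A ℂ) := {σ | IsDensity σ} ∩ {σ | (σ - δ • (1 : Matrix A A ℂ)).PosSemidef}
  let f : Matrix (A × B) (A × B) ℂ → Matrix A A ℂ → ℝ := fun P σ => (ofChoi P σ).trace.re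
  have hδ1 : (δ • (1 : Matrix A A ℂ)).PosDef := Matrix.PosDef.one.smul hδ
  have hsel : ∀ σ ∈ Y, ∃ P ∈ X, f P σ ≤ c := by
    rintro σ ⟨⟨-, htr⟩, hσδ⟩
    have hσ : σ.PosDef := by
      have := Matrix.PosDef.posSemidef_add hσδ hδ1
      rwa [sub_add_cancel] at this
    obtain ⟨P, hP, hPΦ, hle⟩ := exists_posSemidef_re_trace_le_of_posDef hΦ hTP hσ htr
    refine ⟨P, ⟨⟨hP, ?_⟩, hPΦ⟩, hle⟩
    have h1 := re_trace_ofChoi_nonneg hP hσδ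
    rw [map_sub, LinearMap.map_smul_of_tower, Matrix.trace_sub, Matrix.trace_smul, Complex.sub_re,
      Complex.real_smul, Complex.re_ofReal_mul, ← trace_choi, choi_ofChoi] at h1
    have hle' : (ofChoi P σ).trace.re ≤ c := hle
    rw [le_div_iff₀ hδ]
    linarith
  have hYne : Y.Nonempty := by
    refine ⟨_, isDensity_inv_card_smul_one, ?_⟩
    change (_ - _ : Matrix A A ℂ).PosSemidef
    rw [← sub_smul]
    exact Matrix.PosSemidef.one.smul (sub_nonneg.2 hδ')
  have hXne : X.Nonempty := by
    obtain ⟨σ, hσ⟩ := hYne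
    obtain ⟨P, hP, -⟩ := hsel σ hσ
    exact ⟨P, hP⟩
  have hXc : IsCompact X := (isCompact_posSemidef_trace_le _).inter_right
    (isClosed_posSemidef.preimage (f := fun P => P - choi Φ) (by fun_prop))
  have hYc : IsCompact Y := isCompact_density.inter_right
    (isClosed_posSemidef.preimage (f := fun σ => σ - δ • (1 : Matrix A A ℂ)) (by fun_prop))
  have hXconv : Convex ℝ X := by
    rintro P ⟨⟨hP, hPt⟩, hPΦ⟩ Q ⟨⟨hQ, hQt⟩, hQΦ⟩ a b ha hb hab
    refine ⟨⟨(hP.smul ha).add (hQ.smul hb), ?_⟩, ?_⟩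
    · rw [Matrix.trace_add, Matrix.trace_smul, Matrix.trace_smul, Complex.add_re,
        Complex.real_smul, Complex.real_smul, Complex.re_ofReal_mul, Complex.re_ofReal_mul]
      calc a * P.trace.re + b * Q.trace.re ≤ a * (c / δ) + b * (c / δ) := by gcongr
        _ = c / δ := by rw [← add_mul, hab, one_mul]
    · have e : a • P + b • Q - choi Φ = a • (P - choi Φ) + b • (Q - choi Φ) := by
        conv_lhs => rw [← one_smul ℝ (choi Φ), ← hab]
        module
      change (_ - _ : Matrix _ _ ℂ).PosSemidef
      rw [e]
      exact (hPΦ.smul ha).add (hQΦ.smul hb)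
  have hYconv : Convex ℝ Y := by
    rintro P ⟨⟨hP, hPt⟩, hPΦ⟩ Q ⟨⟨hQ, hQt⟩, hQΦ⟩ a b ha hb hab
    refine ⟨⟨(hP.smul ha).add (hQ.smul hb), ?_⟩, ?_⟩
    · rw [Matrix.trace_add, Matrix.trace_smul, Matrix.trace_smul, hPt, hQt, ← add_smul, hab,
        one_smul]
    · have e : a • P + b • Q - δ • (1 : Matrix A A ℂ) =
          a • (P - δ • (1 : Matrix A A ℂ)) + b • (Q - δ • (1 : Matrix A A ℂ)) := by
        conv_lhs => rw [← one_smul ℝ (δ • (1 : Matrix A A ℂ)), ← hab]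
        module
      change (_ - _ : Matrix _ _ ℂ).PosSemidef
      rw [e]
      exact (hPΦ.smul ha).add (hQΦ.smul hb)
  have hf₁ : ∀ σ (a b : ℝ) P Q, f (a • P + b • Q) σ = a * f P σ + b * f Q σ := by
    intro σ a b P Q
    simp only [f, ofChoi_add, ofChoi_smul, LinearMap.add_apply, Matrix.trace_add, Complex.add_re,
      re_trace_smul_apply]
  have hf₂ : ∀ P (a b : ℝ) σ τ, f P (a • σ + b • τ) = a * f P σ + b * f P τ := by
    intro P a b σ τ
    simp only [f, map_add, LinearMap.map_smul_of_tower, Matrix.trace_add, Complex.add_re,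
      Matrix.trace_smul, Complex.real_smul, Complex.re_ofReal_mul]
  obtain ⟨P, hP, σ, hσ, hsaddle⟩ := Sion.exists_isSaddlePointOn (f := f) hXne hXconv hXc
    (fun σ _ => (continuous_re_trace_ofChoi σ).lowerSemicontinuous.lowerSemicontinuousOn X)
    (fun σ _ => ConvexOn.quasiconvexOn
      ⟨hXconv, fun P _ Q _ a b _ _ _ => (hf₁ σ a b P Q).le⟩)
    hYconv hYne hYc
    (fun P _ => (Complex.continuous_re.comp
      (LinearMap.continuous_of_finiteDimensional (ofChoi P)).matrix_trace
        ).upperSemicontinuous.upperSemicontinuousOn Y)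
    (fun P _ => ConcaveOn.quasiconcaveOn
      ⟨hYconv, fun σ _ τ _ a b _ _ _ => (hf₂ P a b σ τ).ge⟩)
  refine ⟨P, hP.1.1, hP.2, fun τ hτ htr => ?_⟩
  -- At the saddle point, `f P τ ≤ f Q σ` for every admissible `Q`; choose the one adapted to `σ`.
  obtain ⟨Q, hQ, hle⟩ := hsel σ hσ
  have hτ' : τ.PosSemidef := by
    have := hτ.add hδ1.posSemidef
    rwa [sub_add_cancel] at this
  exact (hsaddle Q hQ τ ⟨⟨hτ', htr⟩, hτ⟩).trans hle

/-- The output at any state has unit trace, hence trace norm at least one. This makes `r` positive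
below, so division by `r` is allowed. -/
theorem one_le_diamondNorm [Nonempty A] {Φ : OpMap A B} (hΦ : IsHermiticityPreserving Φ)
    (hTP : IsTP Φ) : 1 ≤ diamondNorm Φ := by
  have hρ := isDensity_inv_card_smul_one (A := A × A)
  obtain ⟨P, N, -, hN, hH, hnorm⟩ :=
    exists_posSemidef_sub_eq (hΦ.idTensor (R := A) _ hρ.1.isHermitian)
  have hsub : P.trace.re - N.trace.re = 1 := by
    rw [← Complex.sub_re, ← Matrix.trace_sub, ← hH, hTP.idTensor, hρ.2, Complex.one_re]
  have := (isGreatest_diamondNorm Φ).2 ⟨_, hρ, rfl⟩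
  linarith [re_trace_nonneg hN]

theorem mem_robustnessValues_of_diamondNorm_lt [Nonempty A] {Φ : OpMap A B}
    (hΦ : IsHermiticityPreserving Φ) (hTP : IsTP Φ) {r : ℝ} (hr : diamondNorm Φ < 2 * r + 1) :
    r ∈ robustnessValues Φ := by
  have hD := one_le_diamondNorm hΦ hTP
  have hr0 : 0 < r := by linarith
  set c := (diamondNorm Φ + 1) / 2 with hc
  have hc0 : 0 < c := by linarith
  have hcr : c / (1 + r) < 1 := by rw [div_lt_one (by linarith)]; linarith
  have hn : (0 : ℝ) < Fintype.card A := by exact_mod_cast Fintype.card_pos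
  -- Chosen so that `c / (1 + r) • X / Tr X + δ • 1` is a state. Dropping the nonnegative `δ` term
  -- from its bound `c` leaves the bound `(1 + r) Tr X` at `X`.
  set δ := (1 - c / (1 + r)) / Fintype.card A with hδdef
  have hδ : 0 < δ := div_pos (by linarith) hn
  have hδ' : δ ≤ (Fintype.card A : ℝ)⁻¹ := by
    rw [hδdef, div_eq_mul_inv]
    have : 0 < c / (1 + r) := by positivity
    exact mul_le_of_le_one_left (by positivity) (by linarith)
  have hδn : Fintype.card A * δ = 1 - c / (1 + r) := mul_div_cancel₀ _ hn.ne'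
  obtain ⟨P, hP, hPΦ, hle⟩ := exists_posSemidef_forall_re_trace_le hΦ hTP hδ hδ'
  have hbound : ∀ X : Matrix A A ℂ, X.PosSemidef →
      (ofChoi P X).trace.re ≤ (1 + r) * X.trace.re := by
    intro X hX
    have hXt : (X.trace.re : ℂ) = X.trace :=
      Complex.ext (by simp) (by simpa using (Complex.nonneg_iff.1 hX.trace_nonneg).2)
    rcases (re_trace_nonneg hX).eq_or_lt with ht | ht
    · have : X = 0 := by rw [← hX.trace_eq_zero_iff, ← hXt, ← ht, Complex.ofReal_zero]
      simp [this]
    set t := X.trace.re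
    have h := hle ((c / (1 + r) * t⁻¹) • X + δ • (1 : Matrix A A ℂ)) ?_ ?_
    · have h1 := mul_nonneg hδ.le (re_trace_ofChoi_nonneg hP (Matrix.PosSemidef.one (n := A)))
      simp only [map_add, LinearMap.map_smul_of_tower, Matrix.trace_add, Complex.add_re,
        Matrix.trace_smul, Complex.real_smul, Complex.re_ofReal_mul] at h
      have h2 : c / (1 + r) * t⁻¹ * (ofChoi P X).trace.re ≤ c := by linarith
      have h3 : c / (1 + r) * t⁻¹ * (ofChoi P X).trace.re =
          c * ((ofChoi P X).trace.re / ((1 + r) * t)) := by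
        field_simp
      rw [h3] at h2
      have h4 := (mul_le_iff_le_one_right hc0).1 h2
      rwa [div_le_one (by positivity)] at h4
    · rw [add_sub_cancel_right]
      exact hX.smul (by positivity)
    · rw [Matrix.trace_add, Matrix.trace_smul, Matrix.trace_smul, Matrix.trace_one, ← hXt,
        Complex.real_smul, Complex.real_smul, ← Complex.ofReal_natCast, ← Complex.ofReal_mul,
        ← Complex.ofReal_mul, ← Complex.ofReal_add, mul_assoc, inv_mul_cancel₀ ht.ne', mul_one,
        mul_comm δ, hδn, add_sub_cancel, Complex.ofReal_one]
  have h1r : 0 < 1 + r := by linarith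
  have hcp : IsCP (ofChoi P) := by rwa [isCP_iff, choi_ofChoi]
  have hcp' : IsCP (ofChoi P - Φ) := by rwa [isCP_iff, map_sub, choi_ofChoi]
  -- Since `Φ` preserves the trace, `ofChoi P - Φ` has output trace at most `(1 + r) Tr X - Tr X = r
  -- Tr X`.
  refine mem_robustnessValues_iff.2 ⟨hr0.le, r⁻¹ • (ofChoi P - Φ), (1 + r)⁻¹ • ofChoi P,
    ⟨hcp'.smul (by positivity), fun X hX => ?_⟩, ⟨hcp.smul (by positivity), fun X hX => ?_⟩, ?_⟩
  · rw [re_trace_smul_apply, inv_mul_le_iff₀ hr0, LinearMap.sub_apply, Matrix.trace_sub,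
      Complex.sub_re, hTP]
    linarith [hbound X hX]
  · rw [re_trace_smul_apply, inv_mul_le_iff₀ h1r]
    exact hbound X hX
  · rw [smul_inv_smul₀ h1r.ne', smul_inv_smul₀ hr0.ne', add_sub_cancel]

theorem diamondNorm_eq [Nonempty A] {Φ : OpMap A B} (hΦ : IsHermiticityPreserving Φ)
    (hTP : IsTP Φ) : diamondNorm Φ = 2 * robustness Φ + 1 := by
  refine le_antisymm ?_ ?_
  · obtain ⟨ρ, hρ, h⟩ := (isGreatest_diamondNorm Φ).1
    rw [h]
    exact traceNorm_idTensor_le (isLeast_robustness hΦ).1 hρ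
  · by_contra! h
    have hmem := mem_robustnessValues_of_diamondNorm_lt hΦ hTP
      -- The midpoint exceeds `(‖Φ‖_⋄ - 1) / 2`, so it is feasible, yet it lies below the minimum.
      (r := ((diamondNorm Φ - 1) / 2 + robustness Φ) / 2) (by linarith)
    linarith [(isLeast_robustness hΦ).2 hmem]

omit [DecidableEq A] [DecidableEq B] in
theorem IsCPTP.isCPTNI {Φ : OpMap A B} (h : IsCPTP Φ) : IsCPTNI Φ :=
  ⟨h.1, fun X _ => by rw [h.2]⟩

end Duality
end MapSimulation

end

/-! ### The main theorem. -/

open MapSimulation in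
theorem theorem2 {A B : Type*} [Fintype A] [DecidableEq A] [Nonempty A]
    [Fintype B] [DecidableEq B]
    (Φ : MapSimulation.OpMap A B) (hΦ : MapSimulation.IsHermiticityPreserving Φ) :
    -- the minima that define `R(Φ)` and `S(Φ)` are attained, and they satisfy `S = 2 R + 1`
    IsLeast (MapSimulation.robustnessValues Φ) (MapSimulation.robustness Φ) ∧
    IsLeast (MapSimulation.simulationCosts Φ) (MapSimulation.simulationCost Φ) ∧
    MapSimulation.simulationCost Φ = 2 * MapSimulation.robustness Φ + 1 ∧
    -- the minimum is the same over the simulations with an ancilla of any fixed dimension `d ≥ 2`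
    (∀ d : ℕ, 2 ≤ d →
      IsLeast (MapSimulation.simulationCostsOn (Fin d) Φ) (MapSimulation.simulationCost Φ)) ∧
    (MapSimulation.IsTP Φ →
      -- the maximum that defines the diamond norm is attained and equals `S(Φ)`
      IsGreatest (MapSimulation.diamondValues Φ) (MapSimulation.diamondNorm Φ) ∧
      MapSimulation.simulationCost Φ = MapSimulation.diamondNorm Φ ∧
      -- an optimal simulation by a completely positive and trace-preserving map exists
      ∀ d : ℕ, 2 ≤ d →
        ∃ (Λ : MapSimulation.OpMap (A × Fin d) B) (X : Matrix (Fin d) (Fin d) ℂ),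
          MapSimulation.IsCPTP Λ ∧ MapSimulation.Simulates Φ Λ X ∧
          MapSimulation.traceNorm X = MapSimulation.simulationCost Φ) := by
  have hR := isLeast_robustness hΦ
  rw [simulationCost_eq hΦ]
  refine ⟨hR, isLeast_simulationCosts hΦ, rfl, fun d hd => isLeast_simulationCostsOn hΦ hd,
    fun hTP => ⟨isGreatest_diamondNorm Φ, (diamondNorm_eq hΦ hTP).symm, fun d hd => ?_⟩⟩
  obtain ⟨h0, Λ, Ψ, hΛ, hΨ, h⟩ := mem_robustnessValues_iff.1 hR.1
  -- Completing the optimal pair leaves `r = R(Φ)` unchanged, so the simulation cost does not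
  -- increase.
  obtain ⟨Λ', Ψ', hΛ', hΨ', h'⟩ := exists_isCPTP_of_isTP hTP h0 hΛ hΨ h
  have hk : (⟨0, by lia⟩ : Fin d) ≠ ⟨1, by lia⟩ := by simp
  obtain ⟨X, hX, hnorm⟩ := exists_simulates_traceNorm_eq hΦ hΛ'.isCPTNI hΨ'.isCPTNI h' hk
  refine ⟨_, X, ⟨isCP_blockSum fun k => ?_, isTP_blockSum fun k => ?_⟩, hX, hnorm⟩
  · split_ifs
    exacts [hΨ'.1, hΛ'.1]
  · split_ifs
    exacts [hΨ'.2, hΛ'.2]
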